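/- Consider the polynomial control system $\dot x = A_\star Z(x) + B_\star W(x)u + d$ with state $x\in\mathbb R^n$, input $u\in\mathbb R^m$ and disturbance $d\in\mathbb R^n$, where $Z(x)\in\mathbb R^N$ is a known vector of monomials of $x$ with $Z(0)=0$, $W(x)\in\mathbb R^{M\times m}$ is a known matrix of monomials of $x$ (constants, including $0$, are allowed as entries), and $A_\star\in\mathbb R^{n\times N}$, $B_\star\in\mathbb R^{n\times M}$ are unknown. From samples $x(t_i)$, $u(t_i)$, $\dot x(t_i)$, $i=0,\dots,T-1$, form the data matrices $$Z_0=[Z(x(t_0))\ \cdots\ Z(x(t_{T-1}))],\quad V_0=[W(x(t_0))u(t_0)\ \cdots\ W(x(t_{T-1}))u(t_{T-1})],\quad X_1=[\dot x(t_0)\ \cdots\ \dot x(t_{T-1})].$$ For a given matrix $\Delta$ with $n$ rows let $\mathcal D=\{D\in\mathbb R^{n\times T}: DD^\top\preceq\Delta\Delta^\top\}$, and let $$\tilde{\mathcal C}=\{(A,B): X_1=AZ_0+BV_0+D \text{ for some } D\in\mathcal D\}$$ be the set of pairs consistent with the data. Assume that $S=\begin{bmatrix}Z_0\\V_0\end{bmatrix}$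 has full row rank, and put $$\tilde{\mathbf A}=SS^\top,\quad \tilde{\mathbf B}=-SX_1^\top,\quad \tilde{\mathbf C}=X_1X_1^\top-\Delta\Delta^\top,\quad \tilde Z_c=-\tilde{\mathbf A}^{-1}\tilde{\mathbf B},\quad \tilde{\mathbf Q}=\tilde{\mathbf B}^\top\tilde{\mathbf A}^{-1}\tilde{\mathbf B}-\tilde{\mathbf C}.$$ Then $\tilde{\mathbf A}\succ0$, and $\tilde{\mathbf Q}\succeq 0$ whenever $\tilde{\mathcal C}\neq\emptyset$; $\tilde{\mathbf A}^{-1/2}$ and $\tilde{\mathbf Q}^{1/2}$ denote the positive semidefinite square roots of $\tilde{\mathbf A}^{-1}$ and $\tilde{\mathbf Q}$. Let $\ell_1,\ell_2$ be positive definite polynomials in $x$ (zero at zero and positive elsewhere), with $\ell_1$ radially unbounded ($\ell_1(x)\to+\infty$ as $|x|\to+\infty$). Suppose that there exist polynomials $V$, $k$, $\lambda$ in $x$, with values in $\mathbb R$, $\mathbb R^m$, $\mathbb R$ respectively, with $V(0)=0$ and $k(0)=0$, such that for each $x\in\mathbb R^n$: $V(x)-\ell_1(x)\ge 0$, $\lambda(x)>0$,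 and $$\begin{bmatrix}\ell_2(x)+\frac{\partial V}{\partial x}(x)\tilde Z_c^\top\xi(x)&\star&\star\\ \tilde{\mathbf A}^{-1/2}\xi(x)&-\lambda(x)I&\star\\ \lambda(x)\tilde{\mathbf Q}^{1/2}\frac{\partial V}{\partial x}(x)^\top&0&-4\lambda(x)I\end{bmatrix}\preceq0,\qquad \xi(x)=\begin{bmatrix}Z(x)\\W(x)k(x)\end{bmatrix},$$ where $\star$ stands for the entries that make the matrix symmetric. Then for every $(A,B)\in\tilde{\mathcal C}$ the origin of $$\dot x=f_{A,B}(x):=AZ(x)+BW(x)k(x)$$ is globally asymptotically stable: it is an equilibrium, every initial state has a solution on $[0,\infty)$, the origin is Lyapunov stable, and every solution on $[0,\infty)$ converges to the origin. In particular, whenever the data are generated by $(A_\star,B_\star)$, that is, $\dot x(t_i)=A_\star Z(x(t_i))+B_\star W(x(t_i))u(t_i)+d(t_i)$ for all $i$ with $[d(t_0)\ \cdots\ d(t_{T-1})]\in\mathcal D$, we have $(A_\star,B_\star)\in\tilde{\mathcal C}$ and the origin of $\dot x=f_{A_\star,B_\star}(x)$ is globally asymptotically stable. -/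

import Mathlib

open scoped MatrixOrder Matrix

noncomputable section

namespace PolyData

/-- The state space `ℝⁿ` with its Euclidean norm. -/
abbrev State (n : ℕ) := EuclideanSpace ℝ (Fin n)

/-- Real polynomials in the state variables `x₁, …, xₙ`. -/
abbrev Poly (n : ℕ) := MvPolynomial (Fin n) ℝ

/-- Value of a polynomial at a state. -/
def val {n : ℕ} (p : Poly n) (x : State n) : ℝ := MvPolynomial.eval (fun j => x j) p

/-- Value of a vector of polynomials at a state. -/
def vecVal {n : ℕ} {ι : Type*} (p : ι → Poly n) (x : State n) : ι → ℝ := fun i => val (p i) x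

/-- Value of a matrix of polynomials at a state. -/
def matVal {n : ℕ} {ι κ : Type*} (W : Matrix ι κ (Poly n)) (x : State n) : Matrix ι κ ℝ :=
  Matrix.of fun i j => val (W i j) x

/-- The gradient `(∂V/∂x)(x)` of a polynomial, as a vector. -/
def gradVal {n : ℕ} (V : Poly n) (x : State n) : Fin n → ℝ :=
  fun j => val (MvPolynomial.pderiv j V) x

/-- `p` is a monomial `c x₁^{d₁} ⋯ xₙ^{dₙ}` (the constants, and in particular `0`, included). -/
def IsMonomial {n : ℕ} (p : Poly n) : Prop :=
  ∃ (d : Fin n →₀ ℕ) (c : ℝ), p = MvPolynomial.monomial d c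

/-- A positive definite polynomial: zero at zero and positive elsewhere. -/
def PosDefPoly {n : ℕ} (p : Poly n) : Prop :=
  val p 0 = 0 ∧ ∀ x : State n, x ≠ 0 → 0 < val p x

/-- A radially unbounded polynomial: `p(x) → +∞` as `|x| → +∞`. -/
def RadiallyUnbounded {n : ℕ} (p : Poly n) : Prop :=
  Filter.Tendsto (val p) (Bornology.cobounded (State n)) Filter.atTop

/-! ### Global asymptotic stability -/

/-- `φ` is a solution of `ẋ = f(x)` on `[0, ∞)` (at `t = 0` the derivative is one-sided). -/
def IsSolution {n : ℕ} (f : State n → State n) (φ : ℝ → State n) : Prop :=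
  IsIntegralCurveOn φ (fun _ => f) (Set.Ici 0)

/-- The origin of `ẋ = f(x)` is globally asymptotically stable: it is an equilibrium, every
initial state has a solution on `[0, ∞)`, the origin is Lyapunov stable, and every solution
converges to the origin. -/
structure IsGAS {n : ℕ} (f : State n → State n) : Prop where
  equilibrium : f 0 = 0
  exists_solution : ∀ x₀ : State n, ∃ φ : ℝ → State n, φ 0 = x₀ ∧ IsSolution f φ
  stable : ∀ ε : ℝ, 0 < ε → ∃ δ : ℝ, 0 < δ ∧ ∀ φ : ℝ → State n, IsSolution f φ →
    ‖φ 0‖ < δ → ∀ t : ℝ, 0 ≤ t → ‖φ t‖ < ε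
  attractive : ∀ φ : ℝ → State n, IsSolution f φ → Filter.Tendsto φ Filter.atTop (nhds 0)

/-! ### Data matrices -/

/-- `Z₀ = [Z(x(t₀)) ⋯ Z(x(t_{T-1}))]`. -/
def dataZ {n N T : ℕ} (Z : Fin N → Poly n) (xs : Fin T → State n) : Matrix (Fin N) (Fin T) ℝ :=
  Matrix.of fun i t => vecVal Z (xs t) i

/-- `V₀ = [W(x(t₀))u(t₀) ⋯ W(x(t_{T-1}))u(t_{T-1})]`. -/
def dataV {n m M T : ℕ} (W : Matrix (Fin M) (Fin m) (Poly n)) (xs : Fin T → State n)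
    (us : Fin T → (Fin m → ℝ)) : Matrix (Fin M) (Fin T) ℝ :=
  Matrix.of fun i t => (matVal W (xs t) *ᵥ us t) i

/-- The matrix whose columns are the vectors `v(t₀), …, v(t_{T-1})`. -/
def columns {n T : ℕ} (v : Fin T → (Fin n → ℝ)) : Matrix (Fin n) (Fin T) ℝ :=
  Matrix.of fun i t => v t i

/-- The disturbance model `𝒟 = {D : D Dᵀ ⪯ Δ Δᵀ}`. -/
def disturbances {n q : ℕ} (T : ℕ) (Δ : Matrix (Fin n) (Fin q) ℝ) :
    Set (Matrix (Fin n) (Fin T) ℝ) :=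
  {D | D * Dᵀ ≤ Δ * Δᵀ}

/-- The set of pairs consistent with data,
`{(A, B) : X₁ = A Z₀ + B V₀ + D for some D ∈ 𝒟}`. -/
def consistent {n N M T q : ℕ} (X₁ : Matrix (Fin n) (Fin T) ℝ) (Z₀ : Matrix (Fin N) (Fin T) ℝ)
    (V₀ : Matrix (Fin M) (Fin T) ℝ) (Δ : Matrix (Fin n) (Fin q) ℝ) :
    Set (Matrix (Fin n) (Fin N) ℝ × Matrix (Fin n) (Fin M) ℝ) :=
  {P | ∃ D ∈ disturbances T Δ, X₁ = P.1 * Z₀ + P.2 * V₀ + D}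

/-- The stacked matrix `S = [Z₀; V₀]`. -/
abbrev stack {N M T : ℕ} (Z₀ : Matrix (Fin N) (Fin T) ℝ) (V₀ : Matrix (Fin M) (Fin T) ℝ) :
    Matrix (Fin N ⊕ Fin M) (Fin T) ℝ :=
  Matrix.fromRows Z₀ V₀

/-- `𝐀 = S Sᵀ`. -/
def ellA {N M T : ℕ} (S : Matrix (Fin N ⊕ Fin M) (Fin T) ℝ) :
    Matrix (Fin N ⊕ Fin M) (Fin N ⊕ Fin M) ℝ :=
  S * Sᵀ

/-- `𝐁 = -S X₁ᵀ`. -/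
def ellB {n N M T : ℕ} (X₁ : Matrix (Fin n) (Fin T) ℝ) (S : Matrix (Fin N ⊕ Fin M) (Fin T) ℝ) :
    Matrix (Fin N ⊕ Fin M) (Fin n) ℝ :=
  -(S * X₁ᵀ)

/-- `𝐂 = X₁ X₁ᵀ - Δ Δᵀ`. -/
def ellC {n T q : ℕ} (X₁ : Matrix (Fin n) (Fin T) ℝ) (Δ : Matrix (Fin n) (Fin q) ℝ) :
    Matrix (Fin n) (Fin n) ℝ :=
  X₁ * X₁ᵀ - Δ * Δᵀ

/-- `Z_c = -𝐀⁻¹ 𝐁`. -/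
def ellCenter {n N M T : ℕ} (X₁ : Matrix (Fin n) (Fin T) ℝ)
    (S : Matrix (Fin N ⊕ Fin M) (Fin T) ℝ) : Matrix (Fin N ⊕ Fin M) (Fin n) ℝ :=
  -((ellA S)⁻¹ * ellB X₁ S)

/-- `𝐐 = 𝐁ᵀ 𝐀⁻¹ 𝐁 - 𝐂`. -/
def ellQ {n N M T q : ℕ} (X₁ : Matrix (Fin n) (Fin T) ℝ)
    (S : Matrix (Fin N ⊕ Fin M) (Fin T) ℝ) (Δ : Matrix (Fin n) (Fin q) ℝ) :
    Matrix (Fin n) (Fin n) ℝ :=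
  (ellB X₁ S)ᵀ * (ellA S)⁻¹ * ellB X₁ S - ellC X₁ Δ

/-- `𝐀^{-1/2}`, the positive semidefinite square root of `𝐀⁻¹`. -/
def ellAInvSqrt {N M T : ℕ} (S : Matrix (Fin N ⊕ Fin M) (Fin T) ℝ) :
    Matrix (Fin N ⊕ Fin M) (Fin N ⊕ Fin M) ℝ :=
  CFC.sqrt (ellA S)⁻¹

/-- `𝐐^{1/2}`, the positive semidefinite square root of `𝐐`. -/
def ellQSqrt {n N M T q : ℕ} (X₁ : Matrix (Fin n) (Fin T) ℝ)
    (S : Matrix (Fin N ⊕ Fin M) (Fin T) ℝ) (Δ : Matrix (Fin n) (Fin q) ℝ) :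
    Matrix (Fin n) (Fin n) ℝ :=
  CFC.sqrt (ellQ X₁ S Δ)

/-! ### Closed loop and the matrix inequality -/

/-- The closed-loop vector field `f_{A,B}(x) = A Z(x) + B W(x) k(x)`. -/
def closedLoop {n m N M : ℕ} (Z : Fin N → Poly n) (W : Matrix (Fin M) (Fin m) (Poly n))
    (k : Fin m → Poly n) (A : Matrix (Fin n) (Fin N) ℝ) (B : Matrix (Fin n) (Fin M) ℝ) :
    State n → State n :=
  fun x => WithLp.toLp 2 (A *ᵥ vecVal Z x + B *ᵥ (matVal W x *ᵥ vecVal k x))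

/-- The stacked vector `[Z(x); W(x) k(x)]`. -/
def regressor {n m N M : ℕ} (Z : Fin N → Poly n) (W : Matrix (Fin M) (Fin m) (Poly n))
    (k : Fin m → Poly n) (x : State n) : Fin N ⊕ Fin M → ℝ :=
  Sum.elim (vecVal Z x) (matVal W x *ᵥ vecVal k x)

/-- The symmetric 3-by-3 block matrix
`[a, pᵀ, qᵀ; p, -λ I, 0; q, 0, -4 λ I]` with scalar upper left block `a`. -/
def blockMatrix {ι κ : Type*} [DecidableEq ι] [DecidableEq κ] (a : ℝ) (p : ι → ℝ) (q : κ → ℝ)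
    (lam : ℝ) : Matrix (Unit ⊕ (ι ⊕ κ)) (Unit ⊕ (ι ⊕ κ)) ℝ :=
  Matrix.fromBlocks
    (Matrix.of fun _ _ => a)
    (Matrix.replicateRow Unit (Sum.elim p q))
    (Matrix.replicateCol Unit (Sum.elim p q))
    (Matrix.fromBlocks (-(lam • (1 : Matrix ι ι ℝ))) 0 0 (-((4 * lam) • (1 : Matrix κ κ ℝ))))

/-- The matrix at the state `x` whose negative semidefiniteness expresses the decrease of `V`:
its first block column is
`[ℓ₂(x) + (∂V/∂x)(x) Z_cᵀ [Z(x); W(x)k(x)]; 𝐀^{-1/2} [Z(x); W(x)k(x)]; λ(x) 𝐐^{1/2} (∂V/∂x)(x)ᵀ]`. -/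
def decreaseMatrix {n m N M T q : ℕ} (Z : Fin N → Poly n) (W : Matrix (Fin M) (Fin m) (Poly n))
    (X₁ : Matrix (Fin n) (Fin T) ℝ) (S : Matrix (Fin N ⊕ Fin M) (Fin T) ℝ)
    (Δ : Matrix (Fin n) (Fin q) ℝ) (ℓ₂ V : Poly n) (k : Fin m → Poly n) (lam : Poly n)
    (x : State n) :
    Matrix (Unit ⊕ ((Fin N ⊕ Fin M) ⊕ Fin n)) (Unit ⊕ ((Fin N ⊕ Fin M) ⊕ Fin n)) ℝ :=
  blockMatrix
    (val ℓ₂ x + gradVal V x ⬝ᵥ ((ellCenter X₁ S)ᵀ *ᵥ regressor Z W k x))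
    (ellAInvSqrt S *ᵥ regressor Z W k x)
    (val lam x • (ellQSqrt X₁ S Δ *ᵥ gradVal V x))
    (val lam x)

end PolyData

end

/-!
# Data-driven global stabilization of polynomial systems

Write `G = [A B]` and `ξ = [Z; W k]`, so that the closed loop is `ẋ = G ξ(x)`, and let `g` be the
gradient of `V` at `x`. Completing the square turns the bound on the disturbance into the
membership of `G` in a matrix ellipsoid, `E 𝐀 Eᵀ ⪯ 𝐐` with `E = G - Z_cᵀ`
(`PolyData.le_ellQ_of_mem_consistent`). In particular `𝐐 ⪰ 0` as soon as some system is consistent.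

The derivative of `V` along the closed loop is `g · Z_cᵀ ξ + (Eᵀ g) · ξ`. By Young's inequality in
the norm of `𝐀` (`PolyData.mul_dotProduct_le_inv_add`) and membership in the ellipsoid, the second
term is at most `λ⁻¹ |𝐀^{-1/2} ξ|² + (λ / 4) |𝐐^{1/2} g|²`. The Schur complement of the matrix
inequality (`PolyData.add_div_add_div_nonpos_of_blockMatrix_nonpos`) says exactly that
`g · Z_cᵀ ξ` plus this bound is at most `-ℓ₂(x)`. Hence the one polynomial `V` is a Lyapunov
function for all consistent systems (`PolyData.dotProduct_le_of_decreaseMatrix_nonpos`).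

The conclusion is then Lyapunov's theorem (`PolyData.isGAS_of_lyapunov`). The sublevel sets of
`V ≥ ℓ₁` are bounded, which gives solutions for all time; small values of `V` force small states,
which gives stability; and `ℓ₂` is bounded below on compact sets that miss the origin, so a solution
that stayed away from the origin would drive `V` below zero.
-/

namespace PolyData

/-! ### Calculus of polynomial functions on the state space -/

lemma contDiff_val {n : ℕ} (p : Poly n) {r : WithTop ℕ∞} : ContDiff ℝ r (val p) := by
  unfold val
  induction p using MvPolynomial.induction_on with
  | C a => simpa using contDiff_const
  | add p q hp hq => simpa using hp.add hq
  | mul_X p i hp =>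
    simp only [map_mul, MvPolynomial.eval_X]
    exact hp.mul (by fun_prop)

lemma continuous_val {n : ℕ} (p : Poly n) : Continuous (val p) :=
  (contDiff_val p (r := 0)).continuous

/-- Chain rule: it identifies the formal gradient `gradVal` with the derivative of the polynomial
function along a curve. -/
lemma hasDerivWithinAt_val_comp {n : ℕ} (p : Poly n) {φ : ℝ → State n} {φ' : State n}
    {s : Set ℝ} {t : ℝ} (hφ : HasDerivWithinAt φ φ' s t) :
    HasDerivWithinAt (fun τ => val p (φ τ)) (gradVal p (φ t) ⬝ᵥ φ'.ofLp) s t := by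
  unfold val gradVal
  induction p using MvPolynomial.induction_on with
  | C a => simpa [val, dotProduct] using hasDerivWithinAt_const t s a
  | add p q hp hq =>
    refine ((hp.add hq).congr_deriv ?_).congr (fun τ _ => ?_) ?_ <;>
      simp [val, dotProduct, add_mul, Finset.sum_add_distrib]
  | mul_X p i hp =>
    have hi : HasDerivWithinAt (fun τ => φ τ i) (φ' i) s t :=
      (EuclideanSpace.proj i : State n →L[ℝ] ℝ).hasFDerivAt.comp_hasDerivWithinAt t hφ
    refine ((hp.mul hi).congr_deriv ?_).congr (fun τ _ => ?_) ?_
    · simp only [val, dotProduct, Derivation.leibniz, MvPolynomial.pderiv_X, smul_eq_mul, map_add,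
        map_mul, MvPolynomial.eval_X, add_mul, Finset.sum_add_distrib, Finset.sum_mul]
      rw [add_comm]
      congr 1
      · simp [Pi.single_apply, apply_ite]
      · exact Finset.sum_congr rfl fun j _ => by ring
    all_goals simp

/-! ### Global solutions of Lipschitz bounded vector fields -/

section ODE

open Set Topology
open scoped NNReal

variable {E : Type*} [NormedAddCommGroup E] [NormedSpace ℝ E] [CompleteSpace E]

/-- The boundedness of `f` lets the Picard–Lindelöf theorem give a solution on each interval
`[-a, a]` at once, and the global solution is glued from these by uniqueness. -/
theorem exists_isIntegralCurve_of_lipschitzWith_of_bounded {f : E → E} {K L : ℝ≥0}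
    (hK : LipschitzWith K f) (hL : ∀ x, ‖f x‖ ≤ L) (x₀ : E) :
    ∃ φ : ℝ → E, φ 0 = x₀ ∧ IsIntegralCurve φ (fun _ => f) := by
  have local_sol (a : ℝ) : ∃ φ : ℝ → E, φ 0 = x₀ ∧ ∀ t ∈ Ioo (-a) a, HasDerivAt φ (f (φ t)) t := by
    rcases le_or_gt a 0 with ha | ha
    · exact ⟨fun _ => x₀, rfl, fun t ht => absurd (ht.1.trans ht.2) (by linarith)⟩
    lift a to ℝ≥0 using ha.le
    have hPL : IsPicardLindelof (fun _ => f) (tmin := -(a : ℝ)) (tmax := a)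
        ⟨0, by simp⟩ x₀ (L * a) 0 L K :=
      .of_time_independent (fun x _ => hL x) hK.lipschitzOnWith (by simp)
    obtain ⟨φ, h0, hφ⟩ := hPL.exists_eq_forall_mem_Icc_hasDerivWithinAt₀
    exact ⟨φ, h0, fun t ht => (hφ t (Ioo_subset_Icc_self ht)).hasDerivAt (Icc_mem_nhds ht.1 ht.2)⟩
  choose γ hγ0 hγ using local_sol
  have hEq {a b : ℝ} (ha : 0 < a) (hab : a ≤ b) : EqOn (γ a) (γ b) (Ioo (-a) a) :=
    ODE_solution_unique_of_mem_Ioo (v := fun _ => f) (s := fun _ => univ) (K := K) (t₀ := 0)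
      (fun _ _ => hK.lipschitzOnWith) (by simpa using ha)
      (fun t ht => ⟨hγ a t ht, mem_univ _⟩)
      (fun t ht => ⟨hγ b t ⟨by linarith [ht.1], by linarith [ht.2]⟩, mem_univ _⟩)
      (by rw [hγ0, hγ0])
  -- near `t` the glued curve agrees with the solution on `(-(|t| + 2), |t| + 2)`
  refine ⟨fun t => γ (|t| + 1) t, hγ0 _, fun t => ?_⟩
  have key : (fun s => γ (|s| + 1) s) =ᶠ[𝓝 t] γ (|t| + 2) := by
    filter_upwards [Metric.ball_mem_nhds t one_pos] with s hs
    rw [Metric.mem_ball, Real.dist_eq] at hs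
    have := abs_sub_abs_le_abs_sub s t
    exact hEq (by positivity) (by linarith) (abs_lt.1 (lt_add_one |s|))
  have := hγ (|t| + 2) t (abs_lt.1 (by linarith))
  rw [← key.eq_of_nhds] at this
  exact this.congr_of_eventuallyEq key

end ODE

/-! ### Lyapunov's theorem -/

section Lyapunov

open Set

variable {n : ℕ}

lemma PosDefPoly.nonneg {ℓ : Poly n} (hℓ : PosDefPoly ℓ) (x : State n) : 0 ≤ val ℓ x := by
  rcases eq_or_ne x 0 with rfl | hx
  exacts [hℓ.1.ge, (hℓ.2 x hx).le]

/-- If the derivative of `V` along the solution `φ` is at most `-c`, then `V` decreases along `φ`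
at least at the rate `c`. -/
lemma val_add_mul_le {f : State n → State n} {V : Poly n} {φ : ℝ → State n}
    (hφ : IsSolution f φ) {c : ℝ} (hc : ∀ t, 0 ≤ t → gradVal V (φ t) ⬝ᵥ (f (φ t)).ofLp ≤ -c)
    {t : ℝ} (ht : 0 ≤ t) : val V (φ t) + c * t ≤ val V (φ 0) := by
  have hd : ∀ τ ∈ Ici (0 : ℝ), HasDerivWithinAt (fun τ => val V (φ τ) + c * τ)
      (gradVal V (φ τ) ⬝ᵥ (f (φ τ)).ofLp + c * 1) (Ici 0) τ := fun τ hτ =>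
    (hasDerivWithinAt_val_comp V (hφ τ hτ)).add ((hasDerivWithinAt_id τ _).const_mul c)
  have hanti : AntitoneOn (fun τ => val V (φ τ) + c * τ) (Ici 0) :=
    antitoneOn_of_hasDerivWithinAt_nonpos (convex_Ici 0)
      (fun τ hτ => (hd τ hτ).continuousWithinAt)
      (fun τ hτ => (hd τ (interior_subset hτ)).mono interior_subset)
      fun τ hτ => by linarith [hc τ (interior_subset hτ)]
  simpa using hanti self_mem_Ici ht ht

lemma exists_pos_le_val {ℓ : Poly n} (hℓ : PosDefPoly ℓ) {K : Set (State n)} (hK : IsCompact K)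
    (h0 : (0 : State n) ∉ K) : ∃ c > 0, ∀ x ∈ K, c ≤ val ℓ x := by
  rcases K.eq_empty_or_nonempty with rfl | hne
  · exact ⟨1, one_pos, by simp⟩
  obtain ⟨y, hy, hmin⟩ := hK.exists_isMinOn hne (continuous_val ℓ).continuousOn
  exact ⟨val ℓ y, hℓ.2 y fun h => h0 (h ▸ hy), fun x hx => hmin hx⟩

lemma RadiallyUnbounded.exists_norm_lt {ℓ : Poly n} (hr : RadiallyUnbounded ℓ) (c : ℝ) :
    ∃ R > 0, ∀ x : State n, val ℓ x ≤ c → ‖x‖ < R := by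
  obtain ⟨R, -, hR⟩ := (Filter.hasBasis_cobounded_norm (E := State n)).eventually_iff.1
    (hr.eventually_gt_atTop c)
  refine ⟨max R 1, by positivity, fun x hx => ?_⟩
  by_contra! h
  exact (hR ((le_max_left _ _).trans h)).not_ge hx

/-- Small values of a positive definite, radially unbounded polynomial force small arguments. -/
lemma exists_pos_forall_norm_lt {ℓ : Poly n} (hℓ : PosDefPoly ℓ) (hr : RadiallyUnbounded ℓ)
    {ε : ℝ} (hε : 0 < ε) : ∃ c > 0, ∀ x : State n, val ℓ x < c → ‖x‖ < ε := by
  obtain ⟨R, -, hR⟩ := hr.exists_norm_lt 1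
  obtain ⟨c, hc, hcK⟩ := exists_pos_le_val hℓ
    ((isCompact_closedBall (0 : State n) R).diff (Metric.isOpen_ball (x := (0 : State n)) (ε := ε)))
    (by simp [hε])
  -- points with `‖x‖ ≥ R` have value above `1`, and those with `ε ≤ ‖x‖ ≤ R` at least `c`
  refine ⟨min c 1, by positivity, fun x hx => ?_⟩
  by_contra! hxε
  have h1 := hR x (hx.le.trans (min_le_right _ _))
  exact absurd (hcK x ⟨by simpa using h1.le, by simpa using hxε⟩)
    (not_le.2 (hx.trans_le (min_le_left _ _)))

/-- **Lyapunov's theorem** for global asymptotic stability. Existence of solutions on `[0, ∞)` is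
part of the conclusion: `f` is cut off outside a ball that contains the sublevel set of `V` through
the initial state, which no solution of the cut-off system leaves. -/
theorem isGAS_of_lyapunov {f : State n → State n} (hf : ContDiff ℝ 1 f) (hf0 : f 0 = 0)
    {ℓ₁ ℓ₂ V : Poly n} (hℓ₁ : PosDefPoly ℓ₁) (hr : RadiallyUnbounded ℓ₁) (hℓ₂ : PosDefPoly ℓ₂)
    (hV0 : val V 0 = 0) (hV : ∀ x, val ℓ₁ x ≤ val V x)
    (hdec : ∀ x, gradVal V x ⬝ᵥ (f x).ofLp ≤ -val ℓ₂ x) : IsGAS f := by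
  have hdec0 (x : State n) : gradVal V x ⬝ᵥ (f x).ofLp ≤ 0 := by
    linarith [hdec x, hℓ₂.nonneg x]
  -- `V` does not increase along the solutions of `f`
  have mono {φ : ℝ → State n} (hφ : IsSolution f φ) {t : ℝ} (ht : 0 ≤ t) :
      val V (φ t) ≤ val V (φ 0) := by
    simpa using val_add_mul_le hφ (c := 0) (fun τ _ => by simpa using hdec0 (φ τ)) ht
  have stable : ∀ ε : ℝ, 0 < ε → ∃ δ : ℝ, 0 < δ ∧ ∀ φ : ℝ → State n, IsSolution f φ →
      ‖φ 0‖ < δ → ∀ t : ℝ, 0 ≤ t → ‖φ t‖ < ε := by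
    intro ε hε
    obtain ⟨c, hc, hcε⟩ := exists_pos_forall_norm_lt hℓ₁ hr hε
    obtain ⟨δ, hδ, hδc⟩ := Metric.eventually_nhds_iff.1
      ((continuous_val V).continuousAt.eventually_lt (x₀ := (0 : State n)) continuousAt_const
        (by rwa [hV0] : val V 0 < c))
    refine ⟨δ, hδ, fun φ hφ h0 t ht => hcε _ ?_⟩
    calc val ℓ₁ (φ t) ≤ val V (φ t) := hV _
      _ ≤ val V (φ 0) := mono hφ ht
      _ < c := hδc (by simpa using h0)
  refine ⟨hf0, fun x₀ => ?_, stable, fun φ hφ => ?_⟩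
  -- the curve for the cut-off field stays in the sublevel set of `x₀`, where the field is `f`
  · obtain ⟨R, hRpos, hR⟩ := hr.exists_norm_lt (val V x₀)
    let χ : ContDiffBump (0 : State n) := ⟨R, R + 1, hRpos, by linarith⟩
    have hg : ContDiff ℝ 1 (fun x => χ x • f x) := χ.contDiff.smul hf
    have hgs : HasCompactSupport (fun x => χ x • f x) := χ.hasCompactSupport.smul_right
    obtain ⟨K, hK⟩ := hg.lipschitzWith_of_hasCompactSupport hgs one_ne_zero
    obtain ⟨C, hC⟩ := hgs.exists_bound_of_continuous hg.continuous
    obtain ⟨φ, hφ0, hφ⟩ := exists_isIntegralCurve_of_lipschitzWith_of_bounded hK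
      (L := C.toNNReal) (fun x => (hC x).trans (Real.le_coe_toNNReal C)) x₀
    refine ⟨φ, hφ0, fun t ht => ?_⟩
    have hle : val V (φ t) ≤ val V x₀ := by
      have := val_add_mul_le (V := V) (hφ.isIntegralCurveOn (Ici 0)) (c := 0) (fun τ _ => ?_) ht
      · simpa [hφ0] using this
      · rw [WithLp.ofLp_smul, dotProduct_smul, neg_zero]
        exact mul_nonpos_of_nonneg_of_nonpos χ.nonneg (hdec0 _)
    have hin : ‖φ t‖ < R := hR _ ((hV _).trans hle)
    have hχ : χ (φ t) = 1 := χ.one_of_mem_closedBall (by simpa using hin.le)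
    have h := hφ t
    simp only [hχ, one_smul] at h
    exact h.hasDerivWithinAt
  -- `φ` comes arbitrarily close to the origin, and from then on stability keeps it close
  · have visits : ∀ δ > 0, ∃ t ≥ 0, ‖φ t‖ < δ := by
      by_contra! h
      obtain ⟨δ, hδ, hfar⟩ := h
      obtain ⟨R, -, hR⟩ := hr.exists_norm_lt (val V (φ 0))
      obtain ⟨c, hc, hcK⟩ := exists_pos_le_val hℓ₂
        ((isCompact_closedBall (0 : State n) R).diff
          (Metric.isOpen_ball (x := (0 : State n)) (ε := δ))) (by simp [hδ])
      have hrate (t : ℝ) (ht : 0 ≤ t) : gradVal V (φ t) ⬝ᵥ (f (φ t)).ofLp ≤ -c := by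
        have hin := hR _ ((hV _).trans (mono hφ ht))
        have := hcK (φ t) ⟨by simpa using hin.le, by simpa using hfar t ht⟩
        linarith [hdec (φ t)]
      have hnonneg (x : State n) : 0 ≤ val V x := (hℓ₁.nonneg x).trans (hV x)
      -- by this time `V` would have dropped below zero
      have ht : 0 ≤ (val V (φ 0) + 1) / c := by have := hnonneg (φ 0); positivity
      have h1 := val_add_mul_le hφ hrate ht
      rw [mul_div_cancel₀ _ hc.ne'] at h1
      linarith [hnonneg (φ ((val V (φ 0) + 1) / c))]
    rw [Metric.tendsto_atTop]
    intro ε hε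
    obtain ⟨δ, hδ, hδε⟩ := stable ε hε
    obtain ⟨t₀, ht₀, hlt⟩ := visits δ hδ
    refine ⟨t₀, fun t ht => ?_⟩
    have hshift : IsSolution f (φ ∘ (· + t₀)) :=
      (IsIntegralCurveOn.comp_add hφ t₀).mono fun s hs => by
        rw [mem_vadd_set_iff_neg_vadd_mem, neg_neg, vadd_eq_add]
        exact add_nonneg ht₀ hs
    have := hδε _ hshift (by simpa using hlt) (t - t₀) (sub_nonneg.2 ht)
    simpa using this

end Lyapunov

/-! ### Quadratic forms -/

open Matrix

section QuadraticForms

variable {ι κ : Type*} [Fintype ι] [DecidableEq ι] [Fintype κ] [DecidableEq κ]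

lemma dotProduct_sqrt_mulVec_self {P : Matrix ι ι ℝ} (hP : P.PosSemidef) (v : ι → ℝ) :
    (CFC.sqrt P *ᵥ v) ⬝ᵥ (CFC.sqrt P *ᵥ v) = v ⬝ᵥ (P *ᵥ v) := by
  have hsymm : (CFC.sqrt P)ᵀ = CFC.sqrt P := by
    simpa using (nonneg_iff_posSemidef.1 (CFC.sqrt_nonneg P)).isHermitian.eq
  rw [dotProduct_mulVec, ← mulVec_transpose, hsymm, mulVec_mulVec,
    CFC.sqrt_mul_sqrt_self P hP.nonneg, dotProduct_comm]

/-- Young's inequality in the weighted form `c w·ξ ≤ ξᵀ P⁻¹ ξ + (c² / 4) wᵀ P w`. -/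
lemma mul_dotProduct_le_inv_add {P : Matrix ι ι ℝ} (hP : P.PosDef) (w ξ : ι → ℝ) (c : ℝ) :
    c * (w ⬝ᵥ ξ) ≤ ξ ⬝ᵥ (P⁻¹ *ᵥ ξ) + c ^ 2 / 4 * (w ⬝ᵥ (P *ᵥ w)) := by
  have hdet : IsUnit P.det := (isUnit_iff_isUnit_det P).1 hP.isUnit
  have hsymm : Pᵀ = P := by simpa using hP.isHermitian.eq
  -- the difference of the two sides is the value of the form `P` at `(c / 2) w - P⁻¹ ξ`
  have h := hP.posSemidef.dotProduct_mulVec_nonneg ((c / 2) • w - P⁻¹ *ᵥ ξ)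
  have h1 : P⁻¹ *ᵥ ξ ⬝ᵥ P *ᵥ w = w ⬝ᵥ ξ := by
    rw [dotProduct_mulVec, ← mulVec_transpose, hsymm, mulVec_mulVec, mul_nonsing_inv _ hdet,
      one_mulVec, dotProduct_comm]
  simp only [star_trivial, mulVec_sub, mulVec_smul, mulVec_mulVec, mul_nonsing_inv _ hdet,
    one_mulVec, sub_dotProduct, dotProduct_sub, smul_dotProduct, dotProduct_smul, smul_eq_mul,
    h1] at h
  rw [dotProduct_comm (P⁻¹ *ᵥ ξ) ξ] at h
  linarith

/-- The Schur complement of the block matrix with respect to its diagonal lower right block. -/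
lemma add_div_add_div_nonpos_of_blockMatrix_nonpos {a lam : ℝ} {p : ι → ℝ} {q : κ → ℝ}
    (hlam : 0 < lam) (h : blockMatrix a p q lam ≤ 0) :
    a + p ⬝ᵥ p / lam + q ⬝ᵥ q / (4 * lam) ≤ 0 := by
  rw [le_iff, zero_sub] at h
  -- this vector maximizes the form of `blockMatrix a p q lam` among those with first entry `1`
  have := h.dotProduct_mulVec_nonneg
    (Sum.elim (fun _ => 1) (Sum.elim (lam⁻¹ • p) ((4 * lam)⁻¹ • q)))
  have key : a + p ⬝ᵥ p / lam + q ⬝ᵥ q / (4 * lam) =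
      Sum.elim (fun _ : Unit => (1 : ℝ)) (Sum.elim (lam⁻¹ • p) ((4 * lam)⁻¹ • q)) ⬝ᵥ
      (blockMatrix a p q lam *ᵥ
        Sum.elim (fun _ => 1) (Sum.elim (lam⁻¹ • p) ((4 * lam)⁻¹ • q))) := by
    have hrow : replicateRow Unit (Sum.elim p q) *ᵥ
        Sum.elim (lam⁻¹ • p) ((4 * lam)⁻¹ • q) =
          fun _ => lam⁻¹ * (p ⬝ᵥ p) + (4 * lam)⁻¹ * (q ⬝ᵥ q) := by
      ext; simp [mulVec, replicateRow_apply, sumElim_dotProduct_sumElim]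
    have hcol : replicateCol Unit (Sum.elim p q) *ᵥ (fun _ => (1 : ℝ)) = Sum.elim p q := by
      ext; simp [mulVec, dotProduct]
    have ha : (Matrix.of fun _ _ : Unit => a) *ᵥ (fun _ => (1 : ℝ)) = fun _ => a := by
      ext; simp [mulVec, dotProduct]
    have hunit (u v : Unit → ℝ) : u ⬝ᵥ v = u () * v () := by simp [dotProduct]
    simp only [blockMatrix, fromBlocks_mulVec, Sum.elim_comp_inl, Sum.elim_comp_inr, hrow, hcol,
      ha, sumElim_dotProduct_sumElim, dotProduct_add, neg_mulVec, smul_mulVec, one_mulVec,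
      zero_mulVec, dotProduct_neg, smul_dotProduct, dotProduct_smul, smul_eq_mul, hunit,
      Pi.add_apply, add_zero, zero_add]
    field_simp
    ring
  rw [neg_mulVec, dotProduct_neg, star_trivial, ← key] at this
  linarith

end QuadraticForms

/-! ### The matrix ellipsoid of consistent systems -/

variable {n N M T q : ℕ}

lemma posDef_ellA {S : Matrix (Fin N ⊕ Fin M) (Fin T) ℝ} (hS : S.rank = N + M) :
    (ellA S).PosDef := by
  have hrow : LinearIndependent ℝ S.row := by
    rw [linearIndependent_iff_card_eq_finrank_span, Set.finrank, ← rank_eq_finrank_span_row, hS]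
    simp
  simpa [ellA] using PosDef.mul_conjTranspose_self S (vecMul_injective_iff.2 hrow)

/-- Completing the square: with `G = [A B]`, the bound `D Dᵀ ⪯ Δ Δᵀ` on the residual
`D = X₁ - G S` says that `G` lies in the matrix ellipsoid with centre `Z_cᵀ`, shape `𝐀` and
size `𝐐`. -/
lemma le_ellQ_of_mem_consistent {X₁ : Matrix (Fin n) (Fin T) ℝ} {Z₀ : Matrix (Fin N) (Fin T) ℝ}
    {V₀ : Matrix (Fin M) (Fin T) ℝ} {Δ : Matrix (Fin n) (Fin q) ℝ}
    (hS : (stack Z₀ V₀).rank = N + M) {A : Matrix (Fin n) (Fin N) ℝ}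
    {B : Matrix (Fin n) (Fin M) ℝ} (h : (A, B) ∈ consistent X₁ Z₀ V₀ Δ) :
    (fromCols A B - (ellCenter X₁ (stack Z₀ V₀))ᵀ) * ellA (stack Z₀ V₀) *
      (fromCols A B - (ellCenter X₁ (stack Z₀ V₀))ᵀ)ᵀ ≤ ellQ X₁ (stack Z₀ V₀) Δ := by
  obtain ⟨D, hD, hX⟩ := h
  have hA := posDef_ellA hS
  have hdet : IsUnit (ellA (stack Z₀ V₀)).det := (isUnit_iff_isUnit_det _).1 hA.isUnit
  have hsymm : (ellA (stack Z₀ V₀))ᵀ = ellA (stack Z₀ V₀) := by simpa using hA.isHermitian.eq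
  rw [← fromCols_mul_fromRows] at hX
  change X₁ = fromCols A B * stack Z₀ V₀ + D at hX
  generalize fromCols A B = G at *
  generalize stack Z₀ V₀ = S at *
  obtain rfl : D = X₁ - G * S := by rw [hX]; abel
  rw [← sub_nonneg]
  have : 0 ≤ Δ * Δᵀ - (X₁ - G * S) * (X₁ - G * S)ᵀ := sub_nonneg.2 hD
  convert this using 1
  have e1 : ellA S * (ellA S)⁻¹ = 1 := mul_nonsing_inv _ hdet
  have e2 : (ellA S)⁻¹ * ellA S = 1 := nonsing_inv_mul _ hdet
  have e3 (Y : Matrix (Fin N ⊕ Fin M) (Fin n) ℝ) : ellA S * ((ellA S)⁻¹ * Y) = Y := by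
    rw [← Matrix.mul_assoc, e1, Matrix.one_mul]
  have e4 (Y : Matrix (Fin N ⊕ Fin M) (Fin n) ℝ) : (ellA S)⁻¹ * (ellA S * Y) = Y := by
    rw [← Matrix.mul_assoc, e2, Matrix.one_mul]
  have e5 (Y : Matrix (Fin N ⊕ Fin M) (Fin n) ℝ) : S * (Sᵀ * Y) = ellA S * Y := by
    rw [← Matrix.mul_assoc]; rfl
  simp only [ellCenter, ellQ, ellB, ellC, transpose_sub, transpose_neg, transpose_mul,
    transpose_transpose, Matrix.mul_neg, Matrix.neg_mul, neg_neg, Matrix.sub_mul, Matrix.mul_sub,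
    transpose_nonsing_inv, hsymm, Matrix.mul_assoc, e3, e4, e5]
  abel

/-- Every system consistent with the data satisfies the Lyapunov inequality `∂V/∂x · f ≤ -ℓ₂`,
since the deviation from the centre of the ellipsoid is absorbed by the terms of the Schur
complement. -/
lemma dotProduct_le_of_decreaseMatrix_nonpos {m : ℕ} {Z : Fin N → Poly n}
    {W : Matrix (Fin M) (Fin m) (Poly n)} {X₁ : Matrix (Fin n) (Fin T) ℝ}
    {Z₀ : Matrix (Fin N) (Fin T) ℝ} {V₀ : Matrix (Fin M) (Fin T) ℝ}
    {Δ : Matrix (Fin n) (Fin q) ℝ} (hS : (stack Z₀ V₀).rank = N + M)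
    {A : Matrix (Fin n) (Fin N) ℝ} {B : Matrix (Fin n) (Fin M) ℝ}
    (h : (A, B) ∈ consistent X₁ Z₀ V₀ Δ) {ℓ₂ V lam : Poly n} {k : Fin m → Poly n} {x : State n}
    (hdec : decreaseMatrix Z W X₁ (stack Z₀ V₀) Δ ℓ₂ V k lam x ≤ 0) (hlam : 0 < val lam x) :
    gradVal V x ⬝ᵥ (closedLoop Z W k A B x).ofLp ≤ -val ℓ₂ x := by
  have hloop : (closedLoop Z W k A B x).ofLp = fromCols A B *ᵥ regressor Z W k x := by
    simp [closedLoop, regressor, fromCols_mulVec]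
  have hA := posDef_ellA hS
  have hQ := le_ellQ_of_mem_consistent hS h
  -- without this, the square root of `𝐐` in the matrix inequality would be a junk value
  have hQ0 : (ellQ X₁ (stack Z₀ V₀) Δ).PosSemidef := by
    rw [← nonneg_iff_posSemidef]
    refine le_trans ?_ hQ
    rw [← conjTranspose_eq_transpose_of_trivial (_ - _)]
    exact (hA.posSemidef.mul_mul_conjTranspose_same _).nonneg
  have hschur := add_div_add_div_nonpos_of_blockMatrix_nonpos hlam hdec
  rw [hloop]
  simp only [ellAInvSqrt, ellQSqrt, smul_dotProduct, dotProduct_smul, smul_eq_mul,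
    dotProduct_sqrt_mulVec_self hA.inv.posSemidef, dotProduct_sqrt_mulVec_self hQ0] at hschur
  generalize fromCols A B = G at *
  generalize stack Z₀ V₀ = S at *
  generalize gradVal V x = g at *
  generalize regressor Z W k x = ξ at *
  generalize val lam x = c at *
  set E := G - (ellCenter X₁ S)ᵀ with hE
  have hyoung := mul_dotProduct_le_inv_add hA (Eᵀ *ᵥ g) ξ c
  have hEQ : (Eᵀ *ᵥ g) ⬝ᵥ (ellA S *ᵥ (Eᵀ *ᵥ g)) ≤ g ⬝ᵥ (ellQ X₁ S Δ *ᵥ g) := by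
    have := (le_iff.1 hQ).dotProduct_mulVec_nonneg g
    rw [star_trivial, sub_mulVec, dotProduct_sub, sub_nonneg] at this
    rwa [← mulVec_mulVec, ← mulVec_mulVec, dotProduct_mulVec g, ← mulVec_transpose] at this
  have hsplit : g ⬝ᵥ (G *ᵥ ξ) = g ⬝ᵥ ((ellCenter X₁ S)ᵀ *ᵥ ξ) + (Eᵀ *ᵥ g) ⬝ᵥ ξ := by
    rw [mulVec_transpose E, ← dotProduct_mulVec, hE, sub_mulVec, dotProduct_sub]
    ring
  have hE' : (Eᵀ *ᵥ g) ⬝ᵥ ξ ≤ (ξ ⬝ᵥ ((ellA S)⁻¹ *ᵥ ξ)) / c + c / 4 * (g ⬝ᵥ (ellQ X₁ S Δ *ᵥ g)) := by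
    have : c ^ 2 / 4 * ((Eᵀ *ᵥ g) ⬝ᵥ (ellA S *ᵥ (Eᵀ *ᵥ g))) ≤
      c ^ 2 / 4 * (g ⬝ᵥ (ellQ X₁ S Δ *ᵥ g)) := by gcongr
    refine le_of_mul_le_mul_left (hyoung.trans ?_) hlam
    field_simp
    linarith
  have hq : c * (c * (g ⬝ᵥ (ellQ X₁ S Δ *ᵥ g))) / (4 * c) = c / 4 * (g ⬝ᵥ (ellQ X₁ S Δ *ᵥ g)) := by
    field_simp
  rw [hq] at hschur
  linarith

/-! ### The closed loop and the data model -/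

lemma contDiff_closedLoop {n m N M : ℕ} (Z : Fin N → Poly n) (W : Matrix (Fin M) (Fin m) (Poly n))
    (k : Fin m → Poly n) (A : Matrix (Fin n) (Fin N) ℝ) (B : Matrix (Fin n) (Fin M) ℝ)
    {r : WithTop ℕ∞} : ContDiff ℝ r (closedLoop Z W k A B) := by
  rw [contDiff_euclidean]
  intro i
  simp only [closedLoop, Pi.add_apply, Matrix.mulVec, dotProduct, vecVal, matVal, Matrix.of_apply]
  exact (ContDiff.sum fun j _ => contDiff_const.mul (contDiff_val _)).add
    (ContDiff.sum fun j _ => contDiff_const.mul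
      (ContDiff.sum fun l _ => (contDiff_val _).mul (contDiff_val _)))

lemma closedLoop_zero {n m N M : ℕ} {Z : Fin N → Poly n} (W : Matrix (Fin M) (Fin m) (Poly n))
    {k : Fin m → Poly n} (A : Matrix (Fin n) (Fin N) ℝ) (B : Matrix (Fin n) (Fin M) ℝ)
    (hZ : vecVal Z 0 = 0) (hk : vecVal k 0 = 0) : closedLoop Z W k A B 0 = 0 := by
  simp [closedLoop, hZ, hk]

lemma mem_consistent_of_columns {n m N M T q : ℕ} {Z : Fin N → Poly n}
    {W : Matrix (Fin M) (Fin m) (Poly n)} {xs : Fin T → State n} {us : Fin T → Fin m → ℝ}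
    {xdots ds : Fin T → Fin n → ℝ} {Δ : Matrix (Fin n) (Fin q) ℝ}
    {A : Matrix (Fin n) (Fin N) ℝ} {B : Matrix (Fin n) (Fin M) ℝ}
    (hD : columns ds ∈ disturbances T Δ)
    (h : ∀ t, xdots t = A *ᵥ vecVal Z (xs t) + B *ᵥ (matVal W (xs t) *ᵥ us t) + ds t) :
    (A, B) ∈ consistent (columns xdots) (dataZ Z xs) (dataV W xs us) Δ := by
  refine ⟨columns ds, hD, ?_⟩
  ext i t
  exact congrFun (h t) i

end PolyData

theorem proposition2 {n m N M T q : ℕ}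
    -- regressors of monomials of the state, with `Z(0) = 0`
    (Z : Fin N → PolyData.Poly n) (hZ : ∀ i, PolyData.IsMonomial (Z i))
    (hZ0 : PolyData.vecVal Z 0 = 0)
    (W : Matrix (Fin M) (Fin m) (PolyData.Poly n)) (hW : ∀ i j, PolyData.IsMonomial (W i j))
    -- samples of state, input and state derivative, and the energy bound on the disturbance
    (xs : Fin T → PolyData.State n) (us : Fin T → (Fin m → ℝ)) (xdots : Fin T → (Fin n → ℝ))
    (Δ : Matrix (Fin n) (Fin q) ℝ)
    -- the data matrices
    (Z₀ : Matrix (Fin N) (Fin T) ℝ) (hZ₀ : Z₀ = PolyData.dataZ Z xs)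
    (V₀ : Matrix (Fin M) (Fin T) ℝ) (hV₀ : V₀ = PolyData.dataV W xs us)
    (X₁ : Matrix (Fin n) (Fin T) ℝ) (hX₁ : X₁ = PolyData.columns xdots)
    -- full row rank
    (hrank : (PolyData.stack Z₀ V₀).rank = N + M)
    (ℓ₁ ℓ₂ : PolyData.Poly n) (hℓ₁ : PolyData.PosDefPoly ℓ₁) (hℓ₂ : PolyData.PosDefPoly ℓ₂)
    (hℓ₁r : PolyData.RadiallyUnbounded ℓ₁)
    (V : PolyData.Poly n) (k : Fin m → PolyData.Poly n) (lam : PolyData.Poly n)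
    (hV0 : PolyData.val V 0 = 0) (hk0 : PolyData.vecVal k 0 = 0)
    (hV : ∀ x, 0 ≤ PolyData.val V x - PolyData.val ℓ₁ x)
    (hdec : ∀ x,
      PolyData.decreaseMatrix Z W X₁ (PolyData.stack Z₀ V₀) Δ ℓ₂ V k lam x ≤ 0)
    (hlam : ∀ x, 0 < PolyData.val lam x) :
    (∀ A B, (A, B) ∈ PolyData.consistent X₁ Z₀ V₀ Δ →
      PolyData.IsGAS (PolyData.closedLoop Z W k A B)) ∧
    -- in particular, for every system that generated the data with a disturbance in the model
    (∀ (Astar : Matrix (Fin n) (Fin N) ℝ) (Bstar : Matrix (Fin n) (Fin M) ℝ)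
      (ds : Fin T → (Fin n → ℝ)),
      PolyData.columns ds ∈ PolyData.disturbances T Δ →
      (∀ t, xdots t = Astar *ᵥ PolyData.vecVal Z (xs t)
        + Bstar *ᵥ (PolyData.matVal W (xs t) *ᵥ us t) + ds t) →
      (Astar, Bstar) ∈ PolyData.consistent X₁ Z₀ V₀ Δ ∧
      PolyData.IsGAS (PolyData.closedLoop Z W k Astar Bstar)) := by
  subst hZ₀ hV₀ hX₁
  have gas : ∀ A B, (A, B) ∈ PolyData.consistent (PolyData.columns xdots) (PolyData.dataZ Z xs)
      (PolyData.dataV W xs us) Δ → PolyData.IsGAS (PolyData.closedLoop Z W k A B) :=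
    fun A B h => PolyData.isGAS_of_lyapunov (PolyData.contDiff_closedLoop Z W k A B)
      (PolyData.closedLoop_zero W A B hZ0 hk0) hℓ₁ hℓ₁r hℓ₂ hV0 (fun x => sub_nonneg.1 (hV x))
      fun x => PolyData.dotProduct_le_of_decreaseMatrix_nonpos hrank h (hdec x) (hlam x)
  refine ⟨gas, fun Astar Bstar ds hD h => ?_⟩
  have hmem := PolyData.mem_consistent_of_columns hD h
  exact ⟨hmem, gas _ _ hmem⟩
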